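/- Let $D$ be an abelian group, written additively, and let $L|K$ be a field extension. A $D$-grading $L=\bigoplus_{d\in D}L_d$ of the $K$-algebra $L$ is called \emph{unitary} if $L_0=K$ and every component $L_d$ contains a unit of $L$. A unitary grading is called \emph{co-Galois} if (i) $D$ has no non-zero element of $\ell$-power order in case $\operatorname{char}K=\ell>0$, and (ii) every intermediate field $K\subseteq E\subseteq L$ is of the form $E=\bigoplus_{d\in D'}L_d$ for some subgroup $D'\subseteq D$. Two unitary gradings of $L|K$ (possibly by different groups) are \emph{essentially the same} if their groups of homogeneous units $\bigcup_d (L_d\cap L^\times)\subseteq L^\times$ coincide. For $n\ge 1$ let $\operatorname{red}(n)$ be the product of the distinct prime factors of $n$, and put $\operatorname{ered}(n):=\operatorname{red}(n)$ if $4\nmid n$ and $\operatorname{ered}(n):=2\operatorname{red}(n)$ if $4\mid n$. Let $L|K$ be an extension of finite fields of degree $n$, and let $q=|K|$. Then $L|K$ has a unitary grading (by some abelian group $D$) if and only if $q\equiv 1 \pmod{\operatorname{ered}(n)}$. In this case, every unitary grading of $L|K$ is a co-Galois grading with cyclic grading group, and any two unitary gradings of $L|K$ are essentially the same. -/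

import Mathlib

universe u w v v₁ v₂

/-- The reduction of `n`: the product of the prime factors of `n`. -/
def red (n : ℕ) : ℕ := ∏ p ∈ n.primeFactors, p

/-- The extended reduction of `n`. -/
def ered (n : ℕ) : ℕ := if 4 ∣ n then 2 * red n else red n

section General

variable {A B D : Type*} [CommRing A] [CommRing B] [Algebra A B] [AddCommGroup D] [DecidableEq D]

/-- A `D`-graded `A`-algebra `B` is unitarily graded if the structure map identifies `A` with
the component of degree `0` and if every component contains a unit of `B`. -/
structure IsUnitaryGrading (𝒜 : D → Submodule A B) [GradedAlgebra 𝒜] : Prop where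
  algebraMap_injective : Function.Injective (algebraMap A B)
  mem_zero_iff : ∀ b : B, b ∈ 𝒜 0 ↔ b ∈ Set.range (algebraMap A B)
  exists_unit : ∀ d : D, ∃ x ∈ 𝒜 d, IsUnit x

theorem unit_inv_mem_neg (𝒜 : D → Submodule A B) [GradedAlgebra 𝒜] (x : Bˣ) {d : D}
    (hx : (x : B) ∈ 𝒜 d) : ((x⁻¹ : Bˣ) : B) ∈ 𝒜 (-d) := by
  have h := DirectSum.coe_decompose_mul_add_of_left_mem 𝒜 (i := d) (j := -d)
    (b := ((x⁻¹ : Bˣ) : B)) hx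
  rw [Units.mul_inv, add_neg_cancel,
    DirectSum.decompose_of_mem_same 𝒜 (SetLike.GradedOne.one_mem)] at h
  have h2 : ((x⁻¹ : Bˣ) : B) = (DirectSum.decompose 𝒜 ((x⁻¹ : Bˣ) : B) (-d) : B) := by
    calc ((x⁻¹ : Bˣ) : B)
        = ((x⁻¹ : Bˣ) : B) * ((x : B) * (DirectSum.decompose 𝒜 ((x⁻¹ : Bˣ) : B) (-d) : B)) := by
          rw [← h, mul_one]
      _ = _ := by rw [← mul_assoc, Units.inv_mul, one_mul]
  rw [h2]
  exact SetLike.coe_mem _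

/-- The group of homogeneous units of a graded algebra. -/
def homogeneousUnits (𝒜 : D → Submodule A B) [GradedAlgebra 𝒜] : Subgroup Bˣ where
  carrier := {x | ∃ d : D, (x : B) ∈ 𝒜 d}
  mul_mem' := by
    rintro x y ⟨d, hd⟩ ⟨e, he⟩
    exact ⟨d + e, by rw [Units.val_mul]; exact SetLike.GradedMul.mul_mem hd he⟩
  one_mem' := ⟨0, by rw [Units.val_one]; exact SetLike.GradedOne.one_mem⟩
  inv_mem' := by
    rintro x ⟨d, hd⟩
    exact ⟨-d, unit_inv_mem_neg 𝒜 x hd⟩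

end General

section Fields

variable (K : Type u) (L : Type w) [Field K] [Field L] [Algebra K L]

/-- `L | K` has a unitary grading, by some abelian group `D`. -/
def HasUnitaryGrading : Prop :=
  ∃ (D : Type v) (_ : AddCommGroup D) (_ : DecidableEq D) (𝒜 : D → Submodule K L)
    (_ : GradedAlgebra 𝒜), IsUnitaryGrading 𝒜

variable {K L}

/-- A unitary grading of a field extension `L | K` is co-Galois if `D` has no nonzero element of
`ℓ`-power order when `K` has characteristic `ℓ > 0`, and if every intermediate field is the sum
of the components with degrees in some subgroup of `D`. -/
structure IsCoGaloisGrading {D : Type v} [AddCommGroup D] [DecidableEq D]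
    (𝒜 : D → Submodule K L) [GradedAlgebra 𝒜] : Prop extends IsUnitaryGrading 𝒜 where
  torsion_char : ∀ ℓ : ℕ, ℓ.Prime → CharP K ℓ → ∀ (d : D) (k : ℕ), ℓ ^ k • d = 0 → d = 0
  intermediate_graded : ∀ E : IntermediateField K L, ∃ D' : AddSubgroup D,
    Subalgebra.toSubmodule E.toSubalgebra = ⨆ d ∈ D', 𝒜 d

end Fields

/-! The degree map makes the homogeneous units `H` an extension of `D` by `Kˣ`, and `|D| = n`, so
`|H| = n(q - 1)` (`card_homogeneousUnits`, `card_eq_finrank`). A subgroup of the cyclic group `Lˣ`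
is determined by its order, so `H` is unique, and its quotient `D` is cyclic. The congruence is
forced by elements of `H` of prime order and of order 8 (`prime_dvd_card_sub_one`,
`four_dvd_card_sub_one`). Conversely it gives `n(q - 1) ∣ q ^ m - 1 ↔ n ∣ m`
(`mul_sub_one_dvd_pow_sub_one_iff`): a unit of order `n(q - 1)` then exists, has degree `n`, and its
powers span a grading. The same equivalence, applied to `[E : K]`, shows that intermediate fields
are graded. -/

/-! ### Arithmetic of `ered` and lifting the exponent. -/

theorem red_dvd {n m : ℕ} (h : ∀ p ∈ n.primeFactors, p ∣ m) : red n ∣ m :=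
  Finset.prod_primes_dvd m (fun _ hp => (Nat.prime_of_mem_primeFactors hp).prime) h

theorem dvd_ered {n p : ℕ} (hp : p ∈ n.primeFactors) : p ∣ ered n := by
  have h : p ∣ red n := Finset.dvd_prod_of_mem (fun p => p) hp
  unfold ered
  split_ifs
  · exact h.mul_left 2
  · exact h

theorem four_dvd_ered {n : ℕ} (hn : n ≠ 0) (h : 4 ∣ n) : 4 ∣ ered n := by
  have h2 : 2 ∣ red n := Finset.dvd_prod_of_mem (fun p => p)
    (Nat.mem_primeFactors.2 ⟨Nat.prime_two, (by norm_num : 2 ∣ 4).trans h, hn⟩)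
  rw [ered, if_pos h]
  exact mul_dvd_mul_left 2 h2

theorem ered_dvd {n m : ℕ} (h : ∀ p ∈ n.primeFactors, p ∣ m) (h4 : 4 ∣ n → 4 ∣ m) :
    ered n ∣ m := by
  unfold ered
  split_ifs with hn
  -- `red 0` is an empty product, so `ered 0 = 2`.
  · obtain rfl | h0 := eq_or_ne n 0
    · obtain ⟨k, rfl⟩ := h4 hn
      exact ⟨2 * k, by simp [red]; ring⟩
    have h2 : 2 ∈ n.primeFactors :=
      Nat.mem_primeFactors.2 ⟨Nat.prime_two, (by norm_num : 2 ∣ 4).trans hn, h0⟩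
    have hr : red n = 2 * ∏ p ∈ n.primeFactors.erase 2, p :=
      (Finset.mul_prod_erase _ (fun p => p) h2).symm
    rw [hr, ← mul_assoc]
    refine Nat.Coprime.mul_dvd_of_dvd_of_dvd ?_ (h4 hn) ?_
    · refine Nat.Coprime.prod_right fun p hp => ?_
      rw [Finset.mem_erase] at hp
      exact Nat.Coprime.pow_left 2 ((Nat.coprime_primes Nat.prime_two
        (Nat.prime_of_mem_primeFactors hp.2)).2 hp.1.symm)
    · exact Finset.prod_primes_dvd m
        (fun p hp => (Nat.prime_of_mem_primeFactors (Finset.mem_of_mem_erase hp)).prime)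
        fun p hp => h p (Finset.mem_of_mem_erase hp)
  · exact red_dvd h

theorem modEq_one_ered_iff {n q : ℕ} (hn : n ≠ 0) (hq : 1 ≤ q) :
    q ≡ 1 [MOD ered n] ↔ (∀ p ∈ n.primeFactors, p ∣ q - 1) ∧ (4 ∣ n → 4 ∣ q - 1) := by
  rw [Nat.ModEq.comm, Nat.modEq_iff_dvd' hq]
  exact ⟨fun h => ⟨fun p hp => (dvd_ered hp).trans h, fun h4 => (four_dvd_ered hn h4).trans h⟩,
    fun h => ered_dvd h.1 h.2⟩

theorem padicValNat_two_pow_sub_one_of_odd {q m : ℕ} (hq : 1 < q) (hq2 : Odd q) (hm : Odd m) :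
    padicValNat 2 (q ^ m - 1) = padicValNat 2 (q - 1) := by
  have hs : Odd (∑ i ∈ Finset.range m, q ^ i) := by
    rw [Finset.odd_sum_iff_odd_card_odd, Finset.filter_true_of_mem fun i _ => hq2.pow]
    simpa using hm
  have h : q ^ m - 1 = (q - 1) * ∑ i ∈ Finset.range m, q ^ i := by
    have h1 := Nat.geomSum_eq (m := q) (by omega) m
    rw [h1, Nat.mul_div_cancel' (by simpa using Nat.sub_dvd_pow_sub_pow q 1 m)]
  rw [h, padicValNat.mul (by omega) hs.pos.ne',
    padicValNat.eq_zero_of_not_dvd hs.not_two_dvd_nat, add_zero]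

/-- Lifting the exponent, for all prime factors of `n` at once. -/
theorem mul_sub_one_dvd_pow_sub_one_iff {n q m : ℕ} (hq : 1 < q) (hn : n ≠ 0) (hm : m ≠ 0)
    (h : q ≡ 1 [MOD ered n]) : n * (q - 1) ∣ q ^ m - 1 ↔ n ∣ m := by
  rw [modEq_one_ered_iff hn hq.le] at h
  have hq0 : q - 1 ≠ 0 := by omega
  have hqm : q ^ m - 1 ≠ 0 := by
    have := Nat.one_lt_pow hm hq
    omega
  rw [← Nat.factorization_prime_le_iff_dvd (mul_ne_zero hn hq0) hqm,
    ← Nat.factorization_prime_le_iff_dvd hn hm]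
  refine forall₂_congr fun p hp => ?_
  have : Fact p.Prime := ⟨hp⟩
  rw [Nat.factorization_mul hn hq0, Finsupp.add_apply]
  simp only [Nat.factorization_def _ hp]
  by_cases hpn : p ∣ n
  swap
  · rw [padicValNat.eq_zero_of_not_dvd hpn, zero_add]
    refine iff_of_true ?_ (Nat.zero_le _)
    exact (padicValNat_dvd_iff_le hqm).1 (pow_padicValNat_dvd.trans
      (by simpa using Nat.sub_dvd_pow_sub_pow q 1 m))
  have hpq : p ∣ q - 1 := h.1 p (Nat.mem_primeFactors.2 ⟨hp, hpn, hn⟩)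
  have hpq' : ¬ p ∣ q := fun hd => hp.one_lt.ne' (Nat.dvd_one.1 (by
    have := Nat.dvd_sub hd hpq
    rwa [Nat.sub_sub_self hq.le] at this))
  obtain rfl | hp2 := eq_or_ne p 2
  · have hn1 : 1 ≤ padicValNat 2 n := one_le_padicValNat_of_dvd hn hpn
    have hqo : Odd q := by
      rw [← Nat.not_even_iff_odd, even_iff_two_dvd]
      exact hpq'
    obtain hme | hmo := Nat.even_or_odd m
    · have hl := padicValNat.pow_two_sub_one hq hpq' hm hme
      have hm1 : 1 ≤ padicValNat 2 m := one_le_padicValNat_of_dvd hm hme.two_dvd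
      have hq1 : 1 ≤ padicValNat 2 (q + 1) :=
        one_le_padicValNat_of_dvd (by omega) (by obtain ⟨k, hk⟩ := hqo; omega)
      -- If `4 ∣ n`, then `q ≡ 1` mod 4 and `q + 1` has 2-adic valuation 1. Otherwise `n` has
      -- valuation 1, and both inequalities hold because `m` and `q + 1` are even.
      by_cases h4 : 4 ∣ n
      · have h4q := h.2 h4
        have : ¬ 2 ≤ padicValNat 2 (q + 1) := by
          rw [← padicValNat_dvd_iff_le (by omega)]
          omega
        omega
      · have : ¬ 2 ≤ padicValNat 2 n := by
          rwa [← padicValNat_dvd_iff_le hn]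
        omega
    · rw [padicValNat_two_pow_sub_one_of_odd hq hqo hmo,
        padicValNat.eq_zero_of_not_dvd hmo.not_two_dvd_nat]
      omega
  · have hl := padicValNat.pow_sub_pow (hp.odd_of_ne_two hp2) hq (p := p) (y := 1) hpq hpq' hm
    rw [one_pow] at hl
    omega

/-! ### Finite fields and cyclic groups. -/

/-- The image of `F` already exhausts the at most `|F|` roots of `X ^ |F| - X` in `L`. -/
theorem mem_range_algebraMap_of_pow_card_eq_self {F L : Type*} [Field F] [Finite F] [Field L]
    [Algebra F L] {t : L} (ht : t ^ Nat.card F = t) : t ∈ Set.range (algebraMap F L) := by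
  classical
  have := Fintype.ofFinite F
  rw [Nat.card_eq_fintype_card] at ht
  have h1 := Fintype.one_lt_card (α := F)
  have hne := FiniteField.X_pow_card_sub_X_ne_zero L h1
  have hsub : Finset.univ.image (algebraMap F L) ⊆
      (Polynomial.X ^ Fintype.card F - Polynomial.X : Polynomial L).roots.toFinset := by
    intro y hy
    obtain ⟨a, -, rfl⟩ := Finset.mem_image.1 hy
    simp [← map_pow, FiniteField.pow_card, Polynomial.mem_roots hne]
  have heq := Finset.eq_of_subset_of_card_le hsub (by
    rw [Finset.card_image_of_injective _ (algebraMap F L).injective, Finset.card_univ]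
    refine (Multiset.toFinset_card_le _).trans ((Polynomial.card_roots' _).trans ?_)
    rw [FiniteField.X_pow_card_sub_X_natDegree_eq L h1])
  have ht' : t ∈ (Polynomial.X ^ Fintype.card F - Polynomial.X : Polynomial L).roots.toFinset := by
    simp [Polynomial.mem_roots hne, ht]
  rw [← heq] at ht'
  simpa using ht'

theorem mem_range_algebraMap_of_pow_eq_one {F L : Type*} [Field F] [Finite F] [Field L]
    [Algebra F L] {t : L} (ht : t ^ (Nat.card F - 1) = 1) : t ∈ Set.range (algebraMap F L) := by
  refine mem_range_algebraMap_of_pow_card_eq_self ?_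
  rw [← Nat.sub_add_cancel (Finite.one_lt_card (α := F)).le, pow_succ, ht, one_mul]

theorem Subgroup.eq_ker_powMonoidHom_of_isCyclic {G : Type*} [CommGroup G] [Finite G] [IsCyclic G]
    (H : Subgroup G) : H = (powMonoidHom (Nat.card H) : G →* G).ker := by
  refine Subgroup.eq_of_le_of_card_ge (fun x hx => ?_) ?_
  · exact congrArg Subtype.val (pow_card_eq_one' (G := H) (x := ⟨x, hx⟩))
  · rw [IsCyclic.card_powMonoidHom_ker, Nat.gcd_eq_right H.card_subgroup_dvd_card]

theorem Subgroup.eq_of_card_eq_of_isCyclic {G : Type*} [CommGroup G] [Finite G] [IsCyclic G]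
    {H₁ H₂ : Subgroup G} (h : Nat.card H₁ = Nat.card H₂) : H₁ = H₂ := by
  rw [H₁.eq_ker_powMonoidHom_of_isCyclic, H₂.eq_ker_powMonoidHom_of_isCyclic, h]

/-! ### The degree map and dimension counts. -/

section Degree

variable {K L D : Type*} [Field K] [Field L] [Algebra K L] [AddCommGroup D] [DecidableEq D]
  (𝒜 : D → Submodule K L) [GradedAlgebra 𝒜]

/-- The degree of a homogeneous unit. -/
noncomputable def homogeneousDegree : homogeneousUnits 𝒜 →* Multiplicative D :=
  MonoidHom.mk' (fun x => Multiplicative.ofAdd x.2.choose) fun x y => by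
    rw [← ofAdd_add]
    congr 1
    refine DirectSum.degree_eq_of_mem_mem 𝒜 (x * y).2.choose_spec ?_ (x * y).1.ne_zero
    exact SetLike.GradedMul.mul_mem x.2.choose_spec y.2.choose_spec

variable {𝒜}

theorem homogeneousUnits_mem (x : homogeneousUnits 𝒜) :
    ((x : Lˣ) : L) ∈ 𝒜 (homogeneousDegree 𝒜 x).toAdd :=
  x.2.choose_spec

theorem homogeneousDegree_eq_iff (x : homogeneousUnits 𝒜) (d : D) :
    homogeneousDegree 𝒜 x = Multiplicative.ofAdd d ↔ ((x : Lˣ) : L) ∈ 𝒜 d := by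
  constructor
  · intro h
    simpa [h] using homogeneousUnits_mem x
  · intro h
    exact congrArg Multiplicative.ofAdd
      (DirectSum.degree_eq_of_mem_mem 𝒜 (homogeneousUnits_mem x) h (x : Lˣ).ne_zero)

namespace IsUnitaryGrading

variable (h : IsUnitaryGrading 𝒜)
include h

theorem homogeneousDegree_surjective : Function.Surjective (homogeneousDegree 𝒜) := by
  intro d
  obtain ⟨x, hx, hu⟩ := h.exists_unit d.toAdd
  exact ⟨⟨hu.unit, d.toAdd, hx⟩, (homogeneousDegree_eq_iff _ d.toAdd).2 hx⟩

theorem homogeneousDegree_eq_one_iff (x : homogeneousUnits 𝒜) :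
    homogeneousDegree 𝒜 x = 1 ↔ ((x : Lˣ) : L) ∈ Set.range (algebraMap K L) := by
  rw [← h.mem_zero_iff]
  exact homogeneousDegree_eq_iff x 0

theorem card_ker_homogeneousDegree :
    Nat.card (homogeneousDegree 𝒜).ker = Nat.card Kˣ := by
  let f (c : Kˣ) : (homogeneousDegree 𝒜).ker :=
    ⟨⟨Units.map (algebraMap K L) c, 0, (h.mem_zero_iff _).2 ⟨c, rfl⟩⟩,
      (h.homogeneousDegree_eq_one_iff _).2 ⟨c, rfl⟩⟩
  refine (Nat.card_congr (Equiv.ofBijective f ⟨fun c c' hc => ?_, fun x => ?_⟩)).symm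
  · have : algebraMap K L c = algebraMap K L c' :=
      congrArg (fun x : (homogeneousDegree 𝒜).ker => ((x.1 : Lˣ) : L)) hc
    exact Units.ext ((algebraMap K L).injective this)
  · obtain ⟨c, hc⟩ := (h.homogeneousDegree_eq_one_iff _).1 x.2
    have hc0 : c ≠ 0 := by
      rintro rfl
      exact (x.1 : Lˣ).ne_zero (by rw [← hc, map_zero])
    exact ⟨Units.mk0 c hc0, Subtype.ext (Subtype.ext (Units.ext hc))⟩

theorem card_homogeneousUnits :
    Nat.card (homogeneousUnits 𝒜) = Nat.card D * Nat.card Kˣ := by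
  rw [← Subgroup.card_mul_index (homogeneousDegree 𝒜).ker, Subgroup.index_ker,
    MonoidHom.range_eq_top.2 h.homogeneousDegree_surjective, h.card_ker_homogeneousDegree,
    mul_comm, Subgroup.card_top]
  rfl

theorem eq_span_singleton {d : D} {x : L} (hx : x ∈ 𝒜 d) (hx0 : x ≠ 0) :
    𝒜 d = Submodule.span K {x} := by
  refine le_antisymm (fun y hy => ?_) ((Submodule.span_singleton_le_iff_mem _ _).2 hx)
  have hinv := unit_inv_mem_neg 𝒜 (Units.mk0 x hx0) hx
  have hm := SetLike.GradedMul.mul_mem hy hinv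
  rw [add_neg_cancel, h.mem_zero_iff] at hm
  obtain ⟨c, hc⟩ := hm
  refine Submodule.mem_span_singleton.2 ⟨c, ?_⟩
  rw [Algebra.smul_def, hc]
  simp [hx0]

theorem exists_basis : ∃ b : Module.Basis D K L, ∀ d, 𝒜 d = Submodule.span K {b d} := by
  choose x hx hu using h.exists_unit
  have hi := DirectSum.Decomposition.isInternal 𝒜
  have hs (d : D) := h.eq_span_singleton (hx d) (hu d).ne_zero
  have hli : LinearIndependent K x :=
    hi.submodule_iSupIndep.linearIndependent _ hx fun d => (hu d).ne_zero
  refine ⟨Module.Basis.mk hli ?_, fun d => by rw [hs d, Module.Basis.mk_apply]⟩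
  rw [Submodule.span_range_eq_iSup, ← hi.submodule_iSup_eq_top]
  exact iSup_mono fun d => (hs d).le

theorem card_eq_finrank : Nat.card D = Module.finrank K L := by
  obtain ⟨b, -⟩ := h.exists_basis
  rw [Module.finrank_eq_nat_card_basis b]

theorem finrank_iSup (D' : AddSubgroup D) [Finite D'] :
    Module.finrank K (⨆ d ∈ D', 𝒜 d : Submodule K L) = Nat.card D' := by
  obtain ⟨b, hb⟩ := h.exists_basis
  have := Fintype.ofFinite D'
  have hs : (⨆ d ∈ D', 𝒜 d) = Submodule.span K (Set.range fun d : D' => b d) := by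
    rw [Submodule.span_range_eq_iSup, iSup_subtype]
    simp only [hb]
  have hli : LinearIndependent K fun d : D' => b d :=
    b.linearIndependent.comp _ Subtype.val_injective
  rw [hs, finrank_span_eq_card hli, Nat.card_eq_fintype_card]

end IsUnitaryGrading

end Degree

/-! ### Necessity of the congruence, and the co-Galois property. -/

namespace IsUnitaryGrading

variable {K L D : Type*} [Field K] [Field L] [Algebra K L] [AddCommGroup D] [DecidableEq D]
  {𝒜 : D → Submodule K L} [GradedAlgebra 𝒜] [Finite K] (h : IsUnitaryGrading 𝒜)
include h

theorem pow_eq_one_of_homogeneousDegree_eq_one {x : homogeneousUnits 𝒜}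
    (hx : homogeneousDegree 𝒜 x = 1) : x ^ (Nat.card K - 1) = 1 := by
  obtain ⟨c, hc⟩ := (h.homogeneousDegree_eq_one_iff x).1 hx
  have hc0 : c ≠ 0 := by
    rintro rfl
    exact (x : Lˣ).ne_zero (by rw [← hc, map_zero])
  have := Fintype.ofFinite K
  have h1 := FiniteField.pow_card_sub_one_eq_one c hc0
  rw [← Nat.card_eq_fintype_card] at h1
  refine Subtype.ext (Units.ext ?_)
  change ((x : Lˣ) : L) ^ (Nat.card K - 1) = 1
  rw [← hc, ← map_pow, h1, map_one]

omit h [Finite K] in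
-- Powers of `x` below the order of its degree lie in distinct components, hence are linearly
-- independent.
theorem geom_sum_ne_zero (x : homogeneousUnits 𝒜) (hk : orderOf (homogeneousDegree 𝒜 x) ≠ 0) :
    ∑ i ∈ Finset.range (orderOf (homogeneousDegree 𝒜 x)), ((x : Lˣ) : L) ^ i ≠ 0 := by
  have hi := (DirectSum.Decomposition.isInternal 𝒜).submodule_iSupIndep
  let f (i : Fin (orderOf (homogeneousDegree 𝒜 x))) : D :=
    (homogeneousDegree 𝒜 x ^ (i : ℕ)).toAdd
  have hf : Function.Injective f := fun i j hij =>
    Fin.ext (pow_injOn_Iio_orderOf i.2 j.2 hij)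
  have hmem (i) : ((x : Lˣ) : L) ^ (i : ℕ) ∈ 𝒜 (f i) := by
    have := homogeneousUnits_mem (x ^ (i : ℕ))
    rwa [map_pow] at this
  have hli := (hi.comp hf).linearIndependent _ hmem fun i => pow_ne_zero _ (x : Lˣ).ne_zero
  intro hs
  rw [← Fin.sum_univ_eq_sum_range] at hs
  have := Fintype.linearIndependent_iff.1 hli (fun _ => 1) (by simpa using hs)
    ⟨0, Nat.pos_of_ne_zero hk⟩
  exact one_ne_zero this

variable [Finite L]

/-- Take `x ∈ H` of order `p`. If `p ∤ q - 1`, its degree also has order `p`, yet `1 + x + ⋯ + x ^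
(p - 1) = 0`. -/
theorem prime_dvd_card_sub_one {p : ℕ} (hp : p.Prime) (hpn : p ∣ Module.finrank K L) :
    p ∣ Nat.card K - 1 := by
  have : Fact p.Prime := ⟨hp⟩
  obtain ⟨x, hx⟩ := exists_prime_orderOf_dvd_card' (G := homogeneousUnits 𝒜) p (by
    rw [h.card_homogeneousUnits, h.card_eq_finrank]
    exact hpn.mul_right _)
  by_contra hpq
  have hd : orderOf (homogeneousDegree 𝒜 x) = p := by
    refine (hp.eq_one_or_self_of_dvd _ (hx ▸ orderOf_map_dvd _ x)).resolve_left fun h1 => hpq ?_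
    rw [← hx]
    exact orderOf_dvd_of_pow_eq_one
      (h.pow_eq_one_of_homogeneousDegree_eq_one (orderOf_eq_one_iff.1 h1))
  have hs := geom_sum_ne_zero x (by rw [hd]; exact hp.ne_zero)
  rw [hd] at hs
  have hx1 : ((x : Lˣ) : L) - 1 ≠ 0 := by
    intro h1
    have : x = 1 := Subtype.ext (Units.ext (sub_eq_zero.1 h1))
    rw [this, orderOf_one] at hx
    exact hp.one_lt.ne hx
  refine mul_ne_zero hs hx1 ?_
  have hxp := pow_orderOf_eq_one x
  rw [hx] at hxp
  have hxp' : ((x : Lˣ) : L) ^ p = 1 :=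
    congrArg (fun y : homogeneousUnits 𝒜 => ((y : Lˣ) : L)) hxp
  rw [geom_sum_mul, hxp', sub_self]

/-- If `q ≡ 3` mod 4, then `q ^ 2 ≡ 1` mod 8, so for `x ∈ H` of order 8 the Frobenius swaps `x` and
`x ^ q`. Their sum lies in `K`, although `x` has nonzero degree, different from that of `x ^ q`. -/
theorem four_dvd_card_sub_one (h4 : 4 ∣ Module.finrank K L) : 4 ∣ Nat.card K - 1 := by
  by_contra hq
  have h2 := h.prime_dvd_card_sub_one Nat.prime_two ((by norm_num : 2 ∣ 4).trans h4)
  have hq1 := Finite.one_lt_card (α := K)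
  obtain ⟨g, hg⟩ := IsCyclic.exists_ofOrder_eq_natCard (α := homogeneousUnits 𝒜)
  have h8 : 8 ∣ orderOf g := by
    rw [hg, h.card_homogeneousUnits, h.card_eq_finrank, Nat.card_units]
    exact mul_dvd_mul h4 h2
  obtain ⟨x, hx⟩ : ∃ x : homogeneousUnits 𝒜, orderOf x = 8 :=
    ⟨_, orderOf_pow_orderOf_div (orderOf_pos g).ne' h8⟩
  have hx8 : ((x : Lˣ) : L) ^ 8 = 1 :=
    congrArg (fun y : homogeneousUnits 𝒜 => ((y : Lˣ) : L)) (hx ▸ pow_orderOf_eq_one x)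
  have hqq : ((x : Lˣ) : L) ^ (Nat.card K * Nat.card K) = (x : Lˣ) := by
    rw [pow_eq_pow_mod _ hx8]
    have : Nat.card K * Nat.card K % 8 = 1 := by
      rw [Nat.mul_mod]
      have : Nat.card K % 8 = 3 ∨ Nat.card K % 8 = 7 := by omega
      obtain h | h := this <;> rw [h]
    rw [this, pow_one]
  have hs : ((x : Lˣ) : L) + ((x : Lˣ) : L) ^ Nat.card K ∈ 𝒜 0 := by
    rw [h.mem_zero_iff]
    apply mem_range_algebraMap_of_pow_card_eq_self
    have := Fintype.ofFinite K
    have hadd := map_add (FiniteField.frobeniusAlgHom K L) ((x : Lˣ) : L)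
      (((x : Lˣ) : L) ^ Nat.card K)
    simp only [FiniteField.coe_frobeniusAlgHom, ← Nat.card_eq_fintype_card] at hadd
    rw [hadd, ← pow_mul, hqq, add_comm]
  have hd0 : (homogeneousDegree 𝒜 x).toAdd ≠ 0 := by
    intro hd
    have := orderOf_dvd_of_pow_eq_one (h.pow_eq_one_of_homogeneousDegree_eq_one (x := x) hd)
    rw [hx] at this
    omega
  have hdq : (homogeneousDegree 𝒜 x ^ Nat.card K).toAdd ≠ (homogeneousDegree 𝒜 x).toAdd := by
    intro hd
    -- Equal degrees put `x ^ (q - 1)` in `K`, so `8 ∣ (q - 1) ^ 2`, impossible as `q - 1` is twice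
    -- an odd number.
    have h1 : homogeneousDegree 𝒜 (x ^ (Nat.card K - 1)) = 1 := by
      rw [map_pow, ← mul_eq_right (b := homogeneousDegree 𝒜 x), ← pow_succ,
        Nat.sub_add_cancel hq1.le]
      exact hd
    have h3 := h.pow_eq_one_of_homogeneousDegree_eq_one h1
    rw [← pow_mul] at h3
    have h5 := orderOf_dvd_of_pow_eq_one h3
    rw [hx] at h5
    obtain ⟨k, hk⟩ := h2
    rw [hk, show 2 * k * (2 * k) = 4 * (k * k) by ring,
      show 8 = 4 * 2 by norm_num, Nat.mul_dvd_mul_iff_left (by norm_num),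
      Nat.prime_two.dvd_mul, or_self] at h5
    omega
  have hxq : ((x : Lˣ) : L) ^ Nat.card K ∈ 𝒜 (homogeneousDegree 𝒜 x ^ Nat.card K).toAdd := by
    have := homogeneousUnits_mem (x ^ Nat.card K)
    rwa [map_pow] at this
  have hc := DirectSum.decompose_of_mem_ne 𝒜 hs hd0.symm
  rw [DirectSum.decompose_add, DirectSum.add_apply, Submodule.coe_add,
    DirectSum.decompose_of_mem_same 𝒜 (homogeneousUnits_mem x),
    DirectSum.decompose_of_mem_ne 𝒜 hxq hdq, add_zero] at hc
  exact (x : Lˣ).ne_zero hc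

theorem card_modEq_one : Nat.card K ≡ 1 [MOD ered (Module.finrank K L)] :=
  (modEq_one_ered_iff Module.finrank_pos.ne' Nat.card_pos).2
    ⟨fun _ hp => h.prime_dvd_card_sub_one (Nat.prime_of_mem_primeFactors hp)
      (Nat.dvd_of_mem_primeFactors hp), h.four_dvd_card_sub_one⟩

omit [Finite K] in
theorem isAddCyclic : IsAddCyclic D := by
  rw [← isCyclic_multiplicative_iff]
  exact isCyclic_of_surjective _ h.homogeneousDegree_surjective

theorem eq_zero_of_char_pow_nsmul_eq_zero {ℓ : ℕ} (hℓ : ℓ.Prime) [CharP K ℓ] (d : D) (k : ℕ)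
    (hd : ℓ ^ k • d = 0) : d = 0 := by
  rw [← AddMonoid.addOrderOf_eq_one_iff]
  by_contra h1
  obtain ⟨p, hp, hpd⟩ := Nat.exists_prime_and_dvd h1
  obtain rfl := (Nat.prime_dvd_prime_iff_eq hp hℓ).1
    (hp.dvd_of_dvd_pow (hpd.trans (addOrderOf_dvd_of_nsmul_eq_zero hd)))
  have hpq := h.prime_dvd_card_sub_one hp
    (h.card_eq_finrank ▸ hpd.trans (addOrderOf_dvd_natCard d))
  have hpq' : p ∣ Nat.card K := by
    have := Fintype.ofFinite K
    rw [← CharP.cast_eq_zero_iff K p, Nat.card_eq_fintype_card, FiniteField.cast_card_eq_zero]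
  have := Nat.dvd_sub hpq' hpq
  rw [Nat.sub_sub_self Nat.card_pos] at this
  exact hp.one_lt.ne' (Nat.dvd_one.1 this)

theorem exists_eq_iSup (E : IntermediateField K L) : ∃ D' : AddSubgroup D,
    Subalgebra.toSubmodule E.toSubalgebra = ⨆ d ∈ D', 𝒜 d := by
  have hn0 : Module.finrank K L ≠ 0 := Module.finrank_pos.ne'
  have : Finite D := Nat.finite_of_card_ne_zero (h.card_eq_finrank ▸ hn0)
  have := h.isAddCyclic
  have hm0 : Module.finrank K E ≠ 0 := Module.finrank_pos.ne'
  have hmn : Module.finrank K E ∣ Module.finrank K L :=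
    ⟨_, (Module.finrank_mul_finrank K E L).symm⟩
  have hmod : Nat.card K ≡ 1 [MOD ered (Module.finrank K E)] :=
    (modEq_one_ered_iff hm0 Nat.card_pos).2
      ⟨fun p hp => h.prime_dvd_card_sub_one (Nat.prime_of_mem_primeFactors hp)
        ((Nat.dvd_of_mem_primeFactors hp).trans hmn),
        fun h4 => h.four_dvd_card_sub_one (h4.trans hmn)⟩
  have hdvd := (mul_sub_one_dvd_pow_sub_one_iff Finite.one_lt_card hm0 hm0 hmod).2 dvd_rfl
  -- With `m = [E : K]`, `D'` is the `m`-torsion of the cyclic group `D`, of order `m`. A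
  -- homogeneous unit `x` with degree in `D'` satisfies `x ^ (m(q - 1)) = 1`, hence `x ^ (q ^ m - 1)
  -- = 1`, so `x ∈ E`; dimensions then agree.
  refine ⟨(nsmulAddMonoidHom (Module.finrank K E)).ker,
    (Submodule.eq_of_le_of_finrank_eq (iSup₂_le fun d hd => ?_) ?_).symm⟩
  · obtain ⟨x, hx⟩ := h.homogeneousDegree_surjective (Multiplicative.ofAdd d)
    rw [h.eq_span_singleton ((homogeneousDegree_eq_iff x d).1 hx) (x : Lˣ).ne_zero,
      Submodule.span_singleton_le_iff_mem]
    have h1 : homogeneousDegree 𝒜 (x ^ Module.finrank K E) = 1 := by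
      rw [map_pow, hx, ← ofAdd_nsmul]
      exact congrArg Multiplicative.ofAdd hd
    have h2 := h.pow_eq_one_of_homogeneousDegree_eq_one h1
    rw [← pow_mul] at h2
    obtain ⟨k, hk⟩ := hdvd
    have h3 : ((x : Lˣ) : L) ^ (Nat.card E - 1) = 1 := by
      rw [Module.natCard_eq_pow_finrank (K := K) (V := E), hk]
      refine congrArg (fun y : homogeneousUnits 𝒜 => ((y : Lˣ) : L)) (?_ : x ^ _ = 1)
      rw [pow_mul, h2, one_pow]
    obtain ⟨y, hy⟩ := mem_range_algebraMap_of_pow_eq_one h3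
    rw [← hy]
    exact y.2
  · rw [h.finrank_iSup, IsAddCyclic.card_nsmulAddMonoidHom_ker, h.card_eq_finrank,
      Nat.gcd_eq_right hmn]
    rfl

theorem isCoGaloisGrading : IsCoGaloisGrading 𝒜 where
  toIsUnitaryGrading := h
  torsion_char _ hℓ _ := h.eq_zero_of_char_pow_nsmul_eq_zero hℓ
  intermediate_graded := h.exists_eq_iSup

end IsUnitaryGrading

/-! ### Construction of a grading. -/

section Existence

variable {K : Type u} {L : Type w} [Field K] [Field L] [Algebra K L]

/-- Let `x` be a generator of an extension of degree `n` such that `x ^ n` lies in the base field.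
Then the powers of `x` span the components of a grading by the integers modulo `n`. -/
theorem hasUnitaryGrading_of_pow_mem {n : ℕ} [NeZero n] (hn : Module.finrank K L = n) {x : L}
    (hx0 : x ≠ 0) (hx : (minpoly K x).natDegree = n) {a : K} (ha : algebraMap K L a = x ^ n) :
    HasUnitaryGrading.{u, w, v} K L := by
  have : FiniteDimensional K L := .of_finrank_pos (hn ▸ Nat.pos_of_neZero n)
  let b (d : ULift.{v} (ZMod n)) : L := x ^ d.down.val
  have hli : LinearIndependent K b :=
    (linearIndependent_pow (K := K) x).comp
      (fun d : ULift.{v} (ZMod n) => ⟨d.down.val, (ZMod.val_lt d.down).trans_eq hx.symm⟩)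
      fun d e hde => ULift.down_injective (ZMod.val_injective n (congrArg Fin.val hde))
  have hspan : Submodule.span K (Set.range b) = ⊤ :=
    hli.span_eq_top_of_card_eq_finrank' (by
      rw [hn, ← Nat.card_eq_fintype_card, Nat.card_ulift, Nat.card_zmod])
  have hint : DirectSum.IsInternal fun d => Submodule.span K {b d} :=
    DirectSum.isInternal_submodule_of_iSupIndep_of_iSup_eq_top hli.iSupIndep_span_singleton
      (by rw [← Submodule.span_range_eq_iSup, hspan])
  have hb0 : b 0 = 1 := by simp [b]
  have hmulmem : ∀ {d e : ULift.{v} (ZMod n)} {y z : L}, y ∈ Submodule.span K {b d} →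
      z ∈ Submodule.span K {b e} → y * z ∈ Submodule.span K {b (d + e)} := by
    intro d e y z hy hz
    obtain ⟨c, rfl⟩ := Submodule.mem_span_singleton.1 hy
    obtain ⟨c', rfl⟩ := Submodule.mem_span_singleton.1 hz
    -- Exponents add modulo `n`; each carry contributes a factor `x ^ n = a`.
    refine Submodule.mem_span_singleton.2
      ⟨c * c' * a ^ ((d.down.val + e.down.val) / n), ?_⟩
    have hbde : b (d + e) = x ^ ((d.down.val + e.down.val) % n) := by
      rw [← ZMod.val_add]
      rfl
    have hmul : b d * b e = algebraMap K L a ^ ((d.down.val + e.down.val) / n) * b (d + e) := by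
      rw [hbde, ha, ← pow_mul, ← pow_add, ← pow_add, Nat.div_add_mod]
    rw [smul_mul_smul_comm, hmul, mul_smul, Algebra.smul_def (a ^ _), map_pow]
  let inst : GradedAlgebra fun d => Submodule.span K {b d} :=
    { one_mem := by simp [hb0]
      mul_mem := fun _ _ _ _ => hmulmem
      toDecomposition := hint.chooseDecomposition }
  exact ⟨ULift.{v} (ZMod n), inferInstance, inferInstance, _, inst,
    { algebraMap_injective := (algebraMap K L).injective
      mem_zero_iff := fun y => by
        simp [hb0, Submodule.mem_span_singleton, Algebra.smul_def]
      exists_unit := fun d =>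
        ⟨b d, Submodule.mem_span_singleton_self _, (pow_ne_zero _ hx0).isUnit⟩ }⟩

theorem hasUnitaryGrading_of_modEq [Finite K] [Finite L]
    (h : Nat.card K ≡ 1 [MOD ered (Module.finrank K L)]) : HasUnitaryGrading.{u, w, v} K L := by
  have hn0 : Module.finrank K L ≠ 0 := Module.finrank_pos.ne'
  have : NeZero (Module.finrank K L) := ⟨hn0⟩
  have hq1 := Finite.one_lt_card (α := K)
  obtain ⟨g, hg⟩ := IsCyclic.exists_ofOrder_eq_natCard (α := Lˣ)
  obtain ⟨x, hx⟩ : ∃ x : Lˣ, orderOf x = Module.finrank K L * (Nat.card K - 1) := by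
    refine ⟨_, orderOf_pow_orderOf_div (orderOf_pos g).ne' ?_⟩
    rw [hg, Nat.card_units, Module.natCard_eq_pow_finrank (K := K) (V := L)]
    exact (mul_sub_one_dvd_pow_sub_one_iff hq1 hn0 hn0 h).2 dvd_rfl
  obtain ⟨a, ha⟩ : (x : L) ^ Module.finrank K L ∈ Set.range (algebraMap K L) := by
    apply mem_range_algebraMap_of_pow_eq_one
    rw [← pow_mul, ← Units.val_pow_eq_pow_val, ← hx, pow_orderOf_eq_one, Units.val_one]
  refine hasUnitaryGrading_of_pow_mem rfl x.ne_zero ?_ ha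
  have hint : IsIntegral K (x : L) := Algebra.IsIntegral.isIntegral _
  rw [← IntermediateField.adjoin.finrank hint]
  set F := IntermediateField.adjoin K {(x : L)}
  have hm0 : Module.finrank K F ≠ 0 := Module.finrank_pos.ne'
  -- With `m = [K(x) : K]`, the order `n(q - 1)` of `x` divides `q ^ m - 1`, which forces `n ∣ m`.
  refine Nat.dvd_antisymm ⟨_, (Module.finrank_mul_finrank K F L).symm⟩
    ((mul_sub_one_dvd_pow_sub_one_iff hq1 hn0 hm0 h).1 ?_)
  rw [← hx]
  refine orderOf_dvd_of_pow_eq_one (Units.ext ?_)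
  let y : F := ⟨x, IntermediateField.mem_adjoin_simple_self K (x : L)⟩
  have hy : y ≠ 0 := fun h0 => x.ne_zero (congrArg Subtype.val h0)
  have := Fintype.ofFinite F
  have h1 := FiniteField.pow_card_sub_one_eq_one y hy
  rw [← Nat.card_eq_fintype_card, Module.natCard_eq_pow_finrank (K := K) (V := F)] at h1
  exact congrArg Subtype.val h1

end Existence

theorem mainTheorem9 (K : Type u) (L : Type w) [Field K] [Field L] [Algebra K L]
    [Finite K] [Finite L] (n q : ℕ) (hn : Module.finrank K L = n) (hq : Nat.card K = q) :
    (HasUnitaryGrading.{u, w, v} K L ↔ q ≡ 1 [MOD ered n]) ∧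
    (q ≡ 1 [MOD ered n] →
      (∀ (D : Type v₁) [AddCommGroup D] [DecidableEq D]
        (𝒜 : D → Submodule K L) [GradedAlgebra 𝒜],
        IsUnitaryGrading 𝒜 → IsCoGaloisGrading 𝒜 ∧ IsAddCyclic D) ∧
      (∀ (D₁ : Type v₁) [AddCommGroup D₁] [DecidableEq D₁]
        (D₂ : Type v₂) [AddCommGroup D₂] [DecidableEq D₂]
        (𝒜 : D₁ → Submodule K L) [GradedAlgebra 𝒜]
        (ℬ : D₂ → Submodule K L) [GradedAlgebra ℬ],
        IsUnitaryGrading 𝒜 → IsUnitaryGrading ℬ →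
          homogeneousUnits 𝒜 = homogeneousUnits ℬ)) := by
  subst hn hq
  refine ⟨⟨?_, hasUnitaryGrading_of_modEq⟩, fun _ => ⟨?_, ?_⟩⟩
  · rintro ⟨D, _, _, 𝒜, _, h⟩
    exact h.card_modEq_one
  · intro D _ _ 𝒜 _ h
    exact ⟨h.isCoGaloisGrading, h.isAddCyclic⟩
  · intro D₁ _ _ D₂ _ _ 𝒜 _ ℬ _ h₁ h₂
    refine Subgroup.eq_of_card_eq_of_isCyclic ?_
    rw [h₁.card_homogeneousUnits, h₂.card_homogeneousUnits, h₁.card_eq_finrank,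
      h₂.card_eq_finrank]
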